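/- **Conventions.** For a map $r:X\times X\to X\times X$ write $r(x,y)=({}^xy,x^y)$. The map satisfies **lri** if $({}^xy)^x=y={}^x(y^x)$ for all $x,y\in X$. A *solution* $(X,r)$ is a set $X$ with an involutive map $r$ that satisfies the braid relation $r^{12}r^{23}r^{12}=r^{23}r^{12}r^{23}$ on $X^3$ (where $r^{12}=r\times\mathrm{id}_X$, $r^{23}=\mathrm{id}_X\times r$) and is non-degenerate: all maps $y\mapsto{}^xy$ and $x\mapsto x^y$ are bijective. A *symmetric group* (in the sense of Takeuchi) is a pair $(G,r)$ of a group $G$ and an involutive map $r:G\times G\to G\times G$, $r(a,u)=({}^au,a^u)$, such that for all $a,b,u,v\in G$: ${}^a1=1$, ${}^1u=u$, $1^u=1$, $a^1=a$, ${}^{ab}u={}^a({}^bu)$, $a^{uv}=(a^u)^v$, ${}^a(uv)=({}^au)({}^{a^u}v)$, $(ab)^u=(a^{{}^bu})(b^u)$, and $uv=({}^uv)(u^v)$. Its *associated left brace* is $(G,+,\cdot)$ with $a+b:=a\cdot({}^{a^{-1}}b)$; this makes $(G,+)$ an abelian group with $a(b+c)+a=ab+ac$. The brace satisfies **Raut**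 if $(a+b)^c=a^c+b^c$ for all $a,b,c\in G$. For a solution $(X,r_0)$ let $G(X,r_0)$ be the group generated by $X$ with the relations $xy=zt$ whenever $r_0(x,y)=(z,t)$. There is a unique braiding operator $r$ on $G=G(X,r_0)$ that is compatible with $r_0$ under the canonical map $i:X\to G$, that is, $r\circ(i\times i)=(i\times i)\circ r_0$. With it $(G,r)$ is a symmetric group, called the symmetric group of $(X,r_0)$. **Theorem.** 1. Let $(G,r)$ be a symmetric group that satisfies lri. Then its associated left brace $(G,+,\cdot)$ satisfies Raut, and moreover $$({}^{({}^va)}u)({}^av)=({}^au)({}^{(a^u)}v)\qquad\text{for all }a,u,v\in G.$$ 2. Let $(X,r_0)$ be a solution that satisfies lri, and let $(G,r)$, $G=G(X,r_0)$, be its symmetric group. If the associated left brace $(G,+,\cdot)$ satisfies Raut, then $(G,r)$ satisfies lri. -/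

import Mathlib

namespace YBE

/-! ### Quadratic sets and solutions of the Yang-Baxter equation -/

section Quadratic

variable {X : Type*}

/-- The left action `ˣy` of a quadratic set: `r (x, y) = (ˣy, xʸ)`. -/
def lact (r : X × X → X × X) (x y : X) : X := (r (x, y)).1

/-- The right action `xʸ` of a quadratic set: `r (x, y) = (ˣy, xʸ)`. Here `ract r x y` is `xʸ`. -/
def ract (r : X × X → X × X) (x y : X) : X := (r (x, y)).2

/-- The map `r × id` on `X × X × X`. -/
def r12 (r : X × X → X × X) (p : X × X × X) : X × X × X :=
  ((r (p.1, p.2.1)).1, (r (p.1, p.2.1)).2, p.2.2)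

/-- The map `id × r` on `X × X × X`. -/
def r23 (r : X × X → X × X) (p : X × X × X) : X × X × X :=
  (p.1, r p.2)

/-- A solution, that is, a non-degenerate symmetric set: the map `r` is involutive (in particular
bijective), satisfies the braid relation, and all `y ↦ ˣy` and all `x ↦ xʸ` are bijective. -/
structure IsSolution (r : X × X → X × X) : Prop where
  involutive : ∀ p, r (r p) = p
  braid : ∀ p, r12 r (r23 r (r12 r p)) = r23 r (r12 r (r23 r p))
  lact_bijective : ∀ x, Function.Bijective (fun y => lact r x y)
  ract_bijective : ∀ y, Function.Bijective (fun x => ract r x y)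

/-- Condition **lri**: `(ˣy)ˣ = y = ˣ(yˣ)` for all `x, y`. -/
def Lri (r : X × X → X × X) : Prop :=
  ∀ x y, ract r (lact r x y) x = y ∧ lact r x (ract r y x) = y

end Quadratic

/-! ### Matched pairs, braided groups, symmetric groups in the sense of Takeuchi -/

/-- A matched pair of groups `(S, T, σ)` with `σ (a, u) = (ᵃu, aᵘ)`. -/
structure IsMatchedPair {S T : Type*} [Group S] [Group T] (σ : T × S → S × T) : Prop where
  bijective : Function.Bijective σ
  ml0_one : ∀ a : T, (σ (a, 1)).1 = 1
  one_ml0 : ∀ u : S, (σ (1, u)).1 = u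
  mr0_one : ∀ u : S, (σ (1, u)).2 = 1
  one_mr0 : ∀ a : T, (σ (a, 1)).2 = a
  ml1 : ∀ (a b : T) (u : S), (σ (a * b, u)).1 = (σ (a, (σ (b, u)).1)).1
  mr1 : ∀ (a : T) (u v : S), (σ (a, u * v)).2 = (σ ((σ (a, u)).2, v)).2
  ml2 : ∀ (a : T) (u v : S), (σ (a, u * v)).1 = (σ (a, u)).1 * (σ ((σ (a, u)).2, v)).1
  mr2 : ∀ (a b : T) (u : S), (σ (a * b, u)).2 = (σ (a, (σ (b, u)).1)).2 * (σ (b, u)).2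

/-- A braided group: `(G, G, σ)` is a matched pair and `u v = (ᵘv)(uᵛ)` in `G`. -/
structure IsBraidedGroup {G : Type*} [Group G] (σ : G × G → G × G) : Prop
    extends IsMatchedPair σ where
  m3 : ∀ u v : G, u * v = lact σ u v * ract σ u v

/-- A symmetric group in the sense of Takeuchi: a braided group whose braiding operator is
involutive. -/
structure IsSymmetricGroup {G : Type*} [Group G] (σ : G × G → G × G) : Prop
    extends IsBraidedGroup σ where
  involutive : ∀ p, σ (σ p) = p

/-! ### Left braces -/

/-- A left brace structure on the group `(G, ·)`: an abelian group structure `(G, +)` such that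
`a(b + c) + a = ab + ac`. -/
structure LeftBrace (G : Type*) [Group G] extends AddCommGroup G where
  left_brace : ∀ a b c : G, a * (b + c) + a = a * b + a * c

/-- Condition **Raut**: `(a + b)ᶜ = aᶜ + bᶜ`, where `+` is the addition of the brace `B` and
the right action is that of `σ`. -/
def Raut {G : Type*} [Group G] (σ : G × G → G × G) (B : LeftBrace G) : Prop :=
  ∀ a b c : G, ract σ (B.add a b) c = B.add (ract σ a c) (ract σ b c)

namespace IsSymmetricGroup

variable {G : Type*} [Group G] {σ : G × G → G × G}

/-- The operation `a + b := a · (ᵃ⁻¹b)`. -/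
def add (σ : G × G → G × G) (a b : G) : G := a * lact σ a⁻¹ b

theorem lact_mul (h : IsSymmetricGroup σ) (a b u : G) :
    lact σ (a * b) u = lact σ a (lact σ b u) := h.ml1 a b u

theorem one_lact (h : IsSymmetricGroup σ) (u : G) : lact σ 1 u = u := h.one_ml0 u

theorem lact_inv_lact (h : IsSymmetricGroup σ) (a u : G) : lact σ a⁻¹ (lact σ a u) = u := by
  rw [← h.lact_mul, inv_mul_cancel, h.one_lact]

theorem lact_lact_inv (h : IsSymmetricGroup σ) (a u : G) : lact σ a (lact σ a⁻¹ u) = u := by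
  rw [← h.lact_mul, mul_inv_cancel, h.one_lact]

theorem lact_lact_ract (h : IsSymmetricGroup σ) (a u : G) :
    lact σ (lact σ a u) (ract σ a u) = a := congrArg Prod.fst (h.involutive (a, u))

theorem add_lact (h : IsSymmetricGroup σ) (a b : G) : add σ a (lact σ a b) = a * b := by
  rw [add, h.lact_inv_lact]

theorem add_comm' (h : IsSymmetricGroup σ) (a b : G) : add σ a b = add σ b a := by
  obtain ⟨c, rfl⟩ : ∃ c, lact σ a c = b := ⟨_, h.lact_lact_inv a b⟩
  have h2 := h.add_lact (lact σ a c) (ract σ a c)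
  rw [h.lact_lact_ract] at h2
  rw [h.add_lact, h2, h.m3]

theorem lact_add (h : IsSymmetricGroup σ) (a b c : G) :
    lact σ a (add σ b c) = add σ (lact σ a b) (lact σ a c) := by
  obtain ⟨d, rfl⟩ : ∃ d, lact σ b d = c := ⟨_, h.lact_lact_inv b c⟩
  rw [h.add_lact, ← h.lact_mul, h.m3 a b, h.lact_mul, h.add_lact]
  exact h.ml2 a b d

theorem add_assoc' (h : IsSymmetricGroup σ) (a b c : G) :
    add σ (add σ a b) c = add σ a (add σ b c) := by
  conv_rhs => rw [add, h.lact_add]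
  simp only [add, mul_inv_rev, h.lact_mul, mul_assoc]

/-- The left brace associated to a symmetric group: its addition is `a + b = a · (ᵃ⁻¹b)`. -/
def leftBrace (h : IsSymmetricGroup σ) : LeftBrace G where
  add := add σ
  zero := 1
  neg a := lact σ a a⁻¹
  add_assoc := h.add_assoc'
  zero_add a := by
    change add σ 1 a = a
    rw [add, inv_one, one_mul, h.one_lact]
  add_zero a := by
    change add σ a 1 = a
    rw [add, show lact σ a⁻¹ 1 = 1 from h.ml0_one _, mul_one]
  add_comm := h.add_comm'
  neg_add_cancel a := by
    change add σ (lact σ a a⁻¹) a = 1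
    rw [h.add_comm', h.add_lact, mul_inv_cancel]
  nsmul := @nsmulRec G ⟨1⟩ ⟨add σ⟩
  zsmul := @zsmulRec G ⟨1⟩ ⟨add σ⟩ ⟨fun a => lact σ a a⁻¹⟩ (@nsmulRec G ⟨1⟩ ⟨add σ⟩)
  left_brace a b c := by
    change add σ (a * add σ b c) a = add σ (a * b) (a * c)
    rw [← h.add_lact a (add σ b c), ← h.add_lact a b, ← h.add_lact a c, h.lact_add,
      h.add_assoc', h.add_assoc', h.add_assoc', h.add_comm' (lact σ a c) a]

end IsSymmetricGroup

/-! ### The group of a solution and its braiding operator -/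

section YBGroup

variable {X : Type*}

/-- The defining relators `x y (z t)⁻¹`, for `r (x, y) = (z, t)`. (For `(x, y) = (z, t)` the
relator is trivial.) -/
def rels (r : X × X → X × X) : Set (FreeGroup X) :=
  {w | ∃ x y z t, r (x, y) = (z, t) ∧
    w = FreeGroup.of x * FreeGroup.of y * (FreeGroup.of z * FreeGroup.of t)⁻¹}

/-- The group `G(X, r)` generated by `X` with relations `x y = z t` whenever
`r (x, y) = (z, t)`. -/
abbrev YBGroup (r : X × X → X × X) : Type _ := PresentedGroup (rels r)

/-- The canonical map `X → G(X, r)`. -/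
def ι (r : X × X → X × X) (x : X) : YBGroup r := PresentedGroup.of x

theorem ι_mul (r : X × X → X × X) (x y : X) :
    ι r x * ι r y = ι r (lact r x y) * ι r (ract r x y) := by
  rw [← mul_inv_eq_one]
  refine (PresentedGroup.one_of_mem (rels := rels r)
    (x := FreeGroup.of x * FreeGroup.of y *
      (FreeGroup.of (lact r x y) * FreeGroup.of (ract r x y))⁻¹) ?_)
  exact ⟨x, y, _, _, rfl, rfl⟩

theorem YBGroup.induction {r : X × X → X × X} {P : YBGroup r → Prop}
    (of : ∀ x, P (ι r x)) (one : P 1) (mul : ∀ a b, P a → P b → P (a * b))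
    (inv : ∀ a, P a → P a⁻¹) (a : YBGroup r) : P a := by
  induction a using PresentedGroup.induction_on with
  | _ z =>
    induction z using FreeGroup.induction_on with
    | C1 => simpa using one
    | of x => exact of x
    | inv_of x hx => rw [map_inv]; exact inv _ hx
    | mul a b ha hb => rw [map_mul]; exact mul _ _ ha hb

/-- A map on `X` respecting the relations extends to a homomorphism on `G(X, r)`. -/
def YBGroup.lift {r : X × X → X × X} {H : Type*} [Group H] (f : X → H)
    (hf : ∀ x y, f x * f y = f (lact r x y) * f (ract r x y)) : YBGroup r →* H :=
  PresentedGroup.toGroup (rels := rels r) (f := f) (by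
    rintro w ⟨x, y, z, t, h, rfl⟩
    have := hf x y
    simp only [lact, ract, h] at this
    simp [this])

theorem YBGroup.lift_ι {r : X × X → X × X} {H : Type*} [Group H] (f : X → H)
    (hf : ∀ x y, f x * f y = f (lact r x y) * f (ract r x y)) (x : X) :
    YBGroup.lift f hf (ι r x) = f x :=
  PresentedGroup.toGroup.of _

end YBGroup

namespace IsSolution

variable {X : Type*} {r : X × X → X × X}

theorem l1 (h : IsSolution r) (x y z : X) :
    lact r x (lact r y z) = lact r (lact r x y) (lact r (ract r x y) z) :=
  (congrArg (fun p => p.1) (h.braid (x, y, z))).symm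

theorem mid (h : IsSolution r) (x y z : X) :
    lact r (ract r x (lact r y z)) (ract r y z) =
      ract r (lact r x y) (lact r (ract r x y) z) :=
  (congrArg (fun p => p.2.1) (h.braid (x, y, z))).symm

theorem r1 (h : IsSolution r) (x y z : X) :
    ract r (ract r x y) z = ract r (ract r x (lact r y z)) (ract r y z) :=
  congrArg (fun p => p.2.2) (h.braid (x, y, z))

theorem lact_lact_ract (h : IsSolution r) (x y : X) :
    lact r (lact r x y) (ract r x y) = x := congrArg Prod.fst (h.involutive (x, y))

/-- The canonical left action of `G(X, r)` on `X`. -/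
noncomputable def left (h : IsSolution r) : YBGroup r →* Equiv.Perm X :=
  YBGroup.lift (fun x => Equiv.ofBijective _ (h.lact_bijective x)) (by
    intro x y
    ext z
    exact h.l1 x y z)

/-- The canonical right action of `G(X, r)` on `X`. -/
noncomputable def right (h : IsSolution r) : YBGroup r →* (Equiv.Perm X)ᵐᵒᵖ :=
  YBGroup.lift (fun x => MulOpposite.op (Equiv.ofBijective _ (h.ract_bijective x))) (by
    intro x y
    apply MulOpposite.unop_injective
    ext z
    have h1 := h.r1 z x y
    have h2 := h.r1 z (lact r x y) (ract r x y)
    have h3 : lact r (lact r x y) (ract r x y) = x := h.lact_lact_ract x y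
    have h4 : ract r (lact r x y) (ract r x y) = y := congrArg Prod.snd (h.involutive (x, y))
    rw [h3, h4] at h2
    exact h2.symm)

/-- The element `xᵘ` of `X`, for `x` in `X` and `u` in `G(X, r)`. -/
noncomputable def rX (h : IsSolution r) (x : X) (u : YBGroup r) : X := (h.right u).unop x

theorem left_ι (h : IsSolution r) (x y : X) : h.left (ι r x) y = lact r x y := by
  rw [left, YBGroup.lift_ι]; rfl

theorem rX_ι (h : IsSolution r) (x y : X) : h.rX x (ι r y) = ract r x y := by
  rw [rX, right, YBGroup.lift_ι]; rfl

theorem rX_one (h : IsSolution r) (x : X) : h.rX x 1 = x := by simp [rX]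

theorem rX_mul (h : IsSolution r) (x : X) (u v : YBGroup r) :
    h.rX x (u * v) = h.rX (h.rX x u) v := by simp [rX]

/-- The element `ˣu := x u (xᵘ)⁻¹` of `G(X, r)`, for `x` in `X` and `u` in `G(X, r)`. -/
noncomputable def lX (h : IsSolution r) (x : X) (u : YBGroup r) : YBGroup r :=
  ι r x * u * (ι r (h.rX x u))⁻¹

theorem lX_ι (h : IsSolution r) (x y : X) : h.lX x (ι r y) = ι r (lact r x y) := by
  rw [lX, rX_ι, ι_mul, mul_inv_cancel_right]

theorem lX_one (h : IsSolution r) (x : X) : h.lX x 1 = 1 := by simp [lX, rX_one]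

theorem lX_mul (h : IsSolution r) (x : X) (u v : YBGroup r) :
    h.lX x (u * v) = h.lX x u * h.lX (h.rX x u) v := by
  simp only [lX, rX_mul]; group

theorem lX_inv (h : IsSolution r) (x : X) (u : YBGroup r) :
    h.lX (h.rX x u) u⁻¹ = (h.lX x u)⁻¹ := by
  have := h.lX_mul x u u⁻¹
  rw [mul_inv_cancel, lX_one] at this
  exact eq_inv_of_mul_eq_one_right this.symm

theorem left_lX_rX (h : IsSolution r) (u : YBGroup r) :
    ∀ x, h.left (h.lX x u) (h.rX x u) = x := by
  induction u using YBGroup.induction with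
  | of y => intro x; rw [lX_ι, rX_ι, left_ι, h.lact_lact_ract]
  | one => intro x; simp [lX_one, rX_one]
  | mul u v hu hv =>
    intro x
    rw [lX_mul, rX_mul, map_mul, Equiv.Perm.mul_apply, hv, hu]
  | inv u hu =>
    intro x
    obtain ⟨y, rfl⟩ : ∃ y, h.rX y u = x := (h.right u).unop.surjective x
    rw [lX_inv, ← rX_mul, mul_inv_cancel, rX_one, map_inv, Equiv.Perm.inv_eq_iff_eq]
    exact (hu y).symm

theorem exists_lX (h : IsSolution r) (u : YBGroup r) :
    (∀ x, ∃ v, h.lX x v = u) ∧ (∀ y, ∃ x v, h.lX x v = u ∧ h.rX x v = y) := by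
  induction u using YBGroup.induction with
  | of z =>
    constructor
    · intro x
      obtain ⟨y, hy⟩ := (h.lact_bijective x).2 z
      exact ⟨ι r y, by rw [lX_ι]; exact congrArg _ hy⟩
    · intro y
      refine ⟨lact r z y, ι r (ract r z y), ?_, ?_⟩
      · rw [lX_ι, h.lact_lact_ract]
      · rw [rX_ι]; exact congrArg Prod.snd (h.involutive (z, y))
  | one =>
    exact ⟨fun x => ⟨1, h.lX_one x⟩, fun y => ⟨y, 1, h.lX_one y, h.rX_one y⟩⟩
  | mul a b ha hb =>
    constructor
    · intro x
      obtain ⟨v, hv⟩ := ha.1 x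
      obtain ⟨w, hw⟩ := hb.1 (h.rX x v)
      exact ⟨v * w, by rw [lX_mul, hv, hw]⟩
    · intro y
      obtain ⟨x, w, hw, hx⟩ := hb.2 y
      obtain ⟨x', v, hv, hx'⟩ := ha.2 x
      exact ⟨x', v * w, by rw [lX_mul, hv, hx', hw], by rw [rX_mul, hx', hx]⟩
  | inv a ha =>
    constructor
    · intro x
      obtain ⟨y, v, hv, hy⟩ := ha.2 x
      exact ⟨v⁻¹, by rw [← hy, lX_inv, hv]⟩
    · intro y
      obtain ⟨v, hv⟩ := ha.1 y
      exact ⟨h.rX y v, v⁻¹, by rw [lX_inv, hv], by rw [← rX_mul, mul_inv_cancel, rX_one]⟩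

theorem lX_bijective (h : IsSolution r) (x : X) : Function.Bijective (h.lX x) := by
  refine ⟨?_, fun u => (h.exists_lX u).1 x⟩
  have key : ∀ u, (ι r x)⁻¹ * h.lX x u * ι r ((h.left (h.lX x u))⁻¹ x) = u := by
    intro u
    have : (h.left (h.lX x u))⁻¹ x = h.rX x u := by
      rw [Equiv.Perm.inv_eq_iff_eq]; exact (h.left_lX_rX u x).symm
    rw [this, lX]; group
  intro u v huv
  rw [← key u, ← key v, huv]

theorem rX_comm (h : IsSolution r) (u : YBGroup r) :
    ∀ x y, r (h.rX x (h.lX y u), h.rX y u) =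
      (h.rX (lact r x y) (h.lX (ract r x y) u), h.rX (ract r x y) u) := by
  induction u using YBGroup.induction with
  | of z =>
    intro x y
    simp only [lX_ι, rX_ι]
    exact Prod.ext (h.mid x y z) (h.r1 x y z).symm
  | one => intro x y; simp only [lX_one, rX_one]; rfl
  | mul u v hu hv =>
    intro x y
    have h1 : lact r (h.rX x (h.lX y u)) (h.rX y u) = _ := congrArg Prod.fst (hu x y)
    have h2 : ract r (h.rX x (h.lX y u)) (h.rX y u) = _ := congrArg Prod.snd (hu x y)
    simp only [lX_mul, rX_mul]
    rw [hv, h1, h2]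
  | inv u hu =>
    intro x y
    obtain ⟨q, rfl⟩ : ∃ q, h.rX q u = y := (h.right u).unop.surjective y
    obtain ⟨p, rfl⟩ : ∃ p, h.rX p (h.lX q u) = x :=
      (h.right (h.lX q u)).unop.surjective x
    have h1 : lact r (h.rX p (h.lX q u)) (h.rX q u) = _ := congrArg Prod.fst (hu p q)
    have h2 : ract r (h.rX p (h.lX q u)) (h.rX q u) = _ := congrArg Prod.snd (hu p q)
    rw [h1, h2]
    simp only [lX_inv, ← rX_mul, mul_inv_cancel, rX_one]
    rfl

/-- The left action of `G(X, r)` on itself, extending `u ↦ ˣu`. -/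
noncomputable def lG (h : IsSolution r) : YBGroup r →* Equiv.Perm (YBGroup r) :=
  YBGroup.lift (fun x => Equiv.ofBijective _ (h.lX_bijective x)) (by
    intro x y
    ext u
    change h.lX x (h.lX y u) = h.lX (lact r x y) (h.lX (ract r x y) u)
    have h1 : lact r (h.rX x (h.lX y u)) (h.rX y u) = _ := congrArg Prod.fst (h.rX_comm u x y)
    have h2 : ract r (h.rX x (h.lX y u)) (h.rX y u) = _ := congrArg Prod.snd (h.rX_comm u x y)
    have h3 := ι_mul r (h.rX x (h.lX y u)) (h.rX y u)
    rw [h1, h2] at h3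
    have e : ∀ x y, h.lX x (h.lX y u) =
        (ι r x * ι r y) * u * (ι r (h.rX x (h.lX y u)) * ι r (h.rX y u))⁻¹ := by
      intro x y
      rw [lX]
      conv_lhs => enter [1]; rw [lX]
      group
    rw [e, e, h3, ι_mul])

/-- The braiding operator `r_G (a, u) = (ᵃu, aᵘ)` on `G = G(X, r)`. The left action is the one
just defined and the right action is `aᵘ = (ᵃu)⁻¹ a u`. -/
noncomputable def braiding (h : IsSolution r) (p : YBGroup r × YBGroup r) :
    YBGroup r × YBGroup r :=
  (h.lG p.1 p.2, (h.lG p.1 p.2)⁻¹ * p.1 * p.2)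

theorem lG_ι (h : IsSolution r) (x : X) (u : YBGroup r) : h.lG (ι r x) u = h.lX x u := by
  rw [lG, YBGroup.lift_ι]; rfl

/-- The braiding operator on `G(X, r)` extends `r`. -/
theorem braiding_ι (h : IsSolution r) (x y : X) :
    h.braiding (ι r x, ι r y) = (ι r (lact r x y), ι r (ract r x y)) := by
  simp only [braiding, lG_ι, lX_ι, mul_assoc]
  rw [ι_mul, inv_mul_cancel_left]

/-- `aᵘ` in `G(X, r)`. -/
noncomputable def rG (h : IsSolution r) (a u : YBGroup r) : YBGroup r := (h.lG a u)⁻¹ * a * u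

theorem rG_mul_left (h : IsSolution r) (a b u : YBGroup r) :
    h.rG (a * b) u = h.rG a (h.lG b u) * h.rG b u := by
  simp only [rG, map_mul, Equiv.Perm.mul_apply]; group

theorem m3' (h : IsSolution r) (a u : YBGroup r) : h.lG a u * h.rG a u = a * u := by
  rw [rG]; group

theorem lG_lG_inv (h : IsSolution r) (a u : YBGroup r) : h.lG a (h.lG a⁻¹ u) = u := by
  rw [← Equiv.Perm.mul_apply, ← map_mul, mul_inv_cancel, map_one, Equiv.Perm.one_apply]

theorem rG_inv (h : IsSolution r) (a u : YBGroup r) :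
    h.rG a (h.lG a⁻¹ u) * h.rG a⁻¹ u = 1 := by
  rw [← rG_mul_left, mul_inv_cancel, rG]; simp

theorem lG_mul (h : IsSolution r) (a : YBGroup r) :
    ∀ u v, h.lG a (u * v) = h.lG a u * h.lG (h.rG a u) v := by
  induction a using YBGroup.induction with
  | of x =>
    intro u v
    have : h.rG (ι r x) u = ι r (h.rX x u) := by
      rw [rG, lG_ι, lX]; group
    rw [this, lG_ι, lG_ι, lG_ι, lX_mul]
  | one => intro u v; simp [rG]
  | mul a b ha hb =>
    intro u v
    rw [rG_mul_left]
    simp only [map_mul, Equiv.Perm.mul_apply]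
    rw [hb, ha]
  | inv a ha =>
    intro u v
    apply (h.lG a).injective
    rw [ha, lG_lG_inv, lG_lG_inv, ← Equiv.Perm.mul_apply, ← map_mul, rG_inv, map_one,
      Equiv.Perm.one_apply]

theorem lG_one (h : IsSolution r) (a : YBGroup r) : h.lG a 1 = 1 := by
  induction a using YBGroup.induction with
  | of x => rw [lG_ι, lX_one]
  | one => simp
  | mul a b ha hb => rw [map_mul, Equiv.Perm.mul_apply, hb, ha]
  | inv a ha => rw [map_inv, Equiv.Perm.inv_eq_iff_eq, ha]

theorem lG_ι_ι (h : IsSolution r) (a : YBGroup r) : ∀ x, h.lG a (ι r x) = ι r (h.left a x) := by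
  induction a using YBGroup.induction with
  | of y => intro x; rw [lG_ι, lX_ι, left_ι]
  | one => intro x; simp
  | mul a b ha hb => intro x; simp only [map_mul, Equiv.Perm.mul_apply, hb, ha]
  | inv a ha =>
    intro x
    rw [map_inv, Equiv.Perm.inv_eq_iff_eq, ha, ← Equiv.Perm.mul_apply, ← map_mul,
      mul_inv_cancel, map_one, Equiv.Perm.one_apply]

theorem lG_lG_rG (h : IsSolution r) (a : YBGroup r) :
    ∀ u, h.lG (h.lG a u) (h.rG a u) = a := by
  induction a using YBGroup.induction with
  | of x =>
    intro u
    have : h.rG (ι r x) u = ι r (h.rX x u) := by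
      rw [rG, lG_ι, lX]; group
    rw [this, lG_ι, lG_ι_ι, left_lX_rX]
  | one => intro u; simp [rG, lG_one]
  | mul a b ha hb =>
    intro u
    have hab : h.lG (a * b) u = h.lG a (h.lG b u) := by
      rw [map_mul, Equiv.Perm.mul_apply]
    rw [hab, rG_mul_left, lG_mul, ha]
    have : h.rG (h.lG a (h.lG b u)) (h.rG a (h.lG b u)) = h.lG b u := by
      rw [rG, ha, mul_assoc, m3']; group
    rw [this, hb]
  | inv a ha =>
    intro u
    have h1 := ha (h.lG a⁻¹ u)
    rw [lG_lG_inv] at h1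
    have h2 := h.lG_mul u (h.rG a (h.lG a⁻¹ u)) (h.rG a⁻¹ u)
    have h3 : h.rG u (h.rG a (h.lG a⁻¹ u)) = h.lG a⁻¹ u := by
      rw [rG, h1, rG, lG_lG_inv]; group
    rw [rG_inv, lG_one, h1, h3] at h2
    exact eq_inv_of_mul_eq_one_right h2.symm

/-- `(G(X, r), r_G)` is a symmetric group. -/
theorem isSymmetricGroup (h : IsSolution r) : IsSymmetricGroup h.braiding := by
  have inv : ∀ p, h.braiding (h.braiding p) = p := by
    rintro ⟨a, u⟩
    have h1 := h.lG_lG_rG a u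
    have h2 : h.rG (h.lG a u) (h.rG a u) = u := by
      rw [rG, h1, mul_assoc, m3']; group
    exact Prod.ext h1 h2
  have mr1 : ∀ a u v, h.rG a (u * v) = h.rG (h.rG a u) v := by
    intro a u v
    rw [rG, lG_mul, rG, rG]; group
  exact {
    bijective := Function.Involutive.bijective inv
    ml0_one := h.lG_one
    one_ml0 := fun u => by simp [braiding]
    mr0_one := fun u => by simp [braiding]
    one_mr0 := fun a => by simp [braiding, lG_one]
    ml1 := fun a b u => by simp [braiding]
    mr1 := mr1
    ml2 := h.lG_mul
    mr2 := h.rG_mul_left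
    m3 := fun u v => (h.m3' u v).symm
    involutive := inv }

/-- The braiding operator of `G(X, r)` is the only one on this group that extends `r`. -/
theorem braiding_unique (h : IsSolution r) {σ : YBGroup r × YBGroup r → YBGroup r × YBGroup r}
    (hσ : IsBraidedGroup σ)
    (hι : ∀ x y, σ (ι r x, ι r y) = (ι r (lact r x y), ι r (ract r x y))) :
    σ = h.braiding := by
  have e1 : ∀ u x, (σ (ι r x, u)).1 = h.lX x u ∧ (σ (ι r x, u)).2 = ι r (h.rX x u) := by
    intro u
    induction u using YBGroup.induction with
    | of y => intro x; rw [hι, lX_ι, rX_ι]; exact ⟨rfl, rfl⟩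
    | one => intro x; rw [hσ.ml0_one, hσ.one_mr0, lX_one, rX_one]; exact ⟨rfl, rfl⟩
    | mul u v hu hv =>
      intro x
      rw [hσ.ml2, hσ.mr1, (hu x).1, (hu x).2, (hv _).1, (hv _).2, lX_mul, rX_mul]
      exact ⟨rfl, rfl⟩
    | inv u hu =>
      intro x
      obtain ⟨y, rfl⟩ : ∃ y, h.rX y u = x := (h.right u).unop.surjective x
      have a1 := hσ.ml2 (ι r y) u u⁻¹
      have a2 := hσ.mr1 (ι r y) u u⁻¹
      rw [mul_inv_cancel, (hu y).2] at a1 a2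
      rw [hσ.ml0_one, (hu y).1] at a1
      rw [hσ.one_mr0] at a2
      rw [lX_inv, ← rX_mul, mul_inv_cancel, rX_one]
      exact ⟨eq_inv_of_mul_eq_one_right a1.symm, a2.symm⟩
  have e2 : ∀ a u, (σ (a, u)).1 = h.lG a u := by
    intro a
    induction a using YBGroup.induction with
    | of x => intro u; rw [(e1 u x).1, lG_ι]
    | one => intro u; rw [hσ.one_ml0]; simp
    | mul a b ha hb => intro u; rw [hσ.ml1, hb, ha, map_mul, Equiv.Perm.mul_apply]
    | inv a ha =>
      intro u
      rw [map_inv, eq_comm, Equiv.Perm.inv_eq_iff_eq, ← ha, ← hσ.ml1, mul_inv_cancel,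
        hσ.one_ml0]
  funext ⟨a, u⟩
  have h1 := hσ.m3 a u
  rw [← h.m3' a u, lact, e2] at h1
  exact Prod.ext (e2 a u) (mul_left_cancel h1).symm

end IsSolution

end YBE

/-! Under lri the right action is determined by the left one: `bᵃ` is the left translate of `b` by
`a⁻¹` (`ract_eq_lact_inv`), and conversely this formula gives lri. Raut is then immediate, because
left translations are additive. For the displayed identity, both sides expand `ᵃ(uv)`: one by the
matched pair axiom for the left action, the other by the axiom for `(uv)` acted on from the right by
`a⁻¹`, once it is known that left translations commute with inversion (`lact_inv`). For the
converse, `X` generates the additive group of `G(X, r)`, so additive maps are determined on `X`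
(`eq_of_additive`). Raut makes right translation by a generator additive, lri on `X` identifies it
there with the inverse left translation, and multiplicativity in the acting element extends the
identification to all of `G`. -/

namespace YBE

/-! ### Consequences of lri in a symmetric group. -/

namespace IsSymmetricGroup

variable {G : Type*} [Group G] {σ : G × G → G × G}

theorem add_right_cancel' (h : IsSymmetricGroup σ) {a b c : G}
    (e : add σ a c = add σ b c) : a = b :=
  letI := h.leftBrace.toAddCommGroup
  add_right_cancel (show a + c = b + c from e)

/-- Under **lri** the right action is the inverse of the left action. -/
theorem ract_eq_lact_inv (h : IsSymmetricGroup σ) (hl : Lri σ) (b a : G) :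
    ract σ b a = lact σ a⁻¹ b := by
  have := (hl a (lact σ a⁻¹ b)).1
  rwa [h.lact_lact_inv] at this

theorem lri_of_ract_eq (h : IsSymmetricGroup σ)
    (hr : ∀ b a, ract σ b a = lact σ a⁻¹ b) : Lri σ := fun a b =>
  ⟨by rw [hr, h.lact_inv_lact], by rw [hr, h.lact_lact_inv]⟩

theorem raut_of_lri (h : IsSymmetricGroup σ) (hl : Lri σ) : Raut σ h.leftBrace := by
  intro a b c
  simp only [h.ract_eq_lact_inv hl]
  exact h.lact_add c⁻¹ a b

/-- Involutivity says that `ᵘv` sends `uᵛ` back to `u`; here `uᵛ` is rewritten through lri and `ᵘv`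
is moved to the other side. -/
theorem inv_lact_lact_inv (h : IsSymmetricGroup σ) (hl : Lri σ) (u v : G) :
    lact σ (lact σ u v)⁻¹ u = lact σ v⁻¹ u := by
  have h1 := congrArg (lact σ (lact σ u v)⁻¹) (h.lact_lact_ract u v)
  rw [h.lact_inv_lact, h.ract_eq_lact_inv hl] at h1
  exact h1.symm

/-- Under **lri** the left action commutes with inversion. -/
theorem lact_inv (h : IsSymmetricGroup σ) (hl : Lri σ) (v a : G) :
    lact σ v a⁻¹ = (lact σ v a)⁻¹ := by
  -- The right action fixes 1, so this product is 1. Its second factor is `ᵛa`, and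
  -- `inv_lact_lact_inv` turns the first into `ᵛ(a⁻¹)`.
  have h1 : ract σ (a⁻¹ * a) v⁻¹ = ract σ a⁻¹ (lact σ a v⁻¹) * ract σ a v⁻¹ := h.mr2 _ _ _
  rw [inv_mul_cancel, show ract σ 1 v⁻¹ = 1 from h.mr0_one _, h.ract_eq_lact_inv hl,
    h.ract_eq_lact_inv hl, ← h.inv_lact_lact_inv hl a⁻¹ (lact σ a v⁻¹),
    h.lact_inv_lact, inv_inv] at h1
  exact eq_inv_of_mul_eq_one_left h1.symm

/-- The axiom `mr2` for the right action of `a⁻¹`, read through lri as a statement about the left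
action; `lact_inv` removes the inverse inside the first factor. -/
theorem lact_mul_of_lri (h : IsSymmetricGroup σ) (hl : Lri σ) (a u v : G) :
    lact σ a (u * v) = lact σ (lact σ v a) u * lact σ a v := by
  have h1 : ract σ (u * v) a⁻¹ = ract σ u (lact σ v a⁻¹) * ract σ v a⁻¹ := h.mr2 _ _ _
  simpa only [h.ract_eq_lact_inv hl, h.lact_inv hl, inv_inv] using h1

end IsSymmetricGroup

/-! ### From Raut on `G(X, r)` back to lri. -/

namespace IsSolution

variable {X : Type*} {r : X × X → X × X}

theorem lact_braiding_ι (h : IsSolution r) (g : YBGroup r) (x : X) :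
    lact h.braiding g (ι r x) = ι r (h.left g x) := h.lG_ι_ι g x

/-- Additive maps on the left brace of `G(X, r)` that agree on `X` are equal. -/
theorem eq_of_additive (h : IsSolution r) {f g : YBGroup r → YBGroup r}
    (hf : ∀ a b, f (IsSymmetricGroup.add h.braiding a b) =
      IsSymmetricGroup.add h.braiding (f a) (f b))
    (hg : ∀ a b, g (IsSymmetricGroup.add h.braiding a b) =
      IsSymmetricGroup.add h.braiding (g a) (g b))
    (hf1 : f 1 = 1) (hg1 : g 1 = 1)
    (hι : ∀ x, f (ι r x) = g (ι r x)) (b : YBGroup r) : f b = g b := by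
  have hs := h.isSymmetricGroup
  -- Quantifying over all translates makes the induction close: `ᶜ(ab)` is the sum of `ᶜa` and the
  -- translate of `b` by `ca`. On generators, the left action preserves the image of `X`.
  suffices H : ∀ c, f (lact h.braiding c b) = g (lact h.braiding c b) by
    simpa only [hs.one_lact] using H 1
  induction b using YBGroup.induction with
  | of x => intro c; rw [lact_braiding_ι, hι]
  | one => intro c; rw [show lact h.braiding c 1 = 1 from hs.ml0_one c, hf1, hg1]
  | mul a b ha hb =>
    intro c
    rw [← hs.add_lact, hs.lact_add, hf, hg, ha, ← hs.lact_mul, hb]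
  | inv a ha =>
    intro c
    -- This is `ᶜ(a⁻¹a)` expanded as a sum. Since 1 is the additive zero, the values of `f` and `g`
    -- at `ᶜ(a⁻¹)` follow by cancellation.
    have e : IsSymmetricGroup.add h.braiding (lact h.braiding c a⁻¹)
        (lact h.braiding (c * a⁻¹) a) = 1 := by
      rw [hs.lact_mul, ← hs.lact_add, hs.add_lact, inv_mul_cancel]
      exact hs.ml0_one c
    have e1 := congrArg f e
    have e2 := congrArg g e
    rw [hf, hf1, ha] at e1
    rw [hg, hg1] at e2
    exact hs.add_right_cancel' (e1.trans e2.symm)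

theorem ract_ι_eq_lact_inv (h : IsSolution r) (hl : Lri r)
    (hR : Raut h.braiding h.isSymmetricGroup.leftBrace) (x : X) (b : YBGroup r) :
    ract h.braiding b (ι r x) = lact h.braiding (ι r x)⁻¹ b := by
  have hs := h.isSymmetricGroup
  refine h.eq_of_additive (f := fun b => ract h.braiding b (ι r x))
    (g := lact h.braiding (ι r x)⁻¹) (fun a b => hR a b (ι r x)) (hs.lact_add _)
    (hs.mr0_one _) (hs.ml0_one _) (fun y => ?_) b
  have h1 : ract h.braiding (ι r y) (ι r x) = ι r (ract r y x) :=
    congrArg Prod.snd (h.braiding_ι y x)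
  -- The only use of lri on `X`: on generators, left translation by `x` undoes right translation by
  -- `x`.
  have h2 : lact h.braiding (ι r x) (ι r (ract r y x)) = ι r y := by
    rw [lact_braiding_ι, left_ι, (hl x y).2]
  change ract h.braiding (ι r y) (ι r x) = _
  rw [h1, ← h2, hs.lact_inv_lact]

theorem lri_braiding (h : IsSolution r) (hl : Lri r)
    (hR : Raut h.braiding h.isSymmetricGroup.leftBrace) : Lri h.braiding := by
  have hs := h.isSymmetricGroup
  have hm : ∀ b u v, ract h.braiding b (u * v) =
    ract h.braiding (ract h.braiding b u) v := hs.mr1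
  -- Both `b ↦ bᵃ` and left translation by `a⁻¹` are right actions in `a`, so agreement on
  -- generators propagates; `b` must vary in the induction.
  refine hs.lri_of_ract_eq fun b a => ?_
  induction a using YBGroup.induction generalizing b with
  | of x => exact h.ract_ι_eq_lact_inv hl hR x b
  | one => rw [inv_one, hs.one_lact]; exact hs.one_mr0 b
  | mul u v hu hv => rw [hm, hu, hv, mul_inv_rev, hs.lact_mul]
  | inv u hu =>
    have h1 := hu (lact h.braiding u b)
    rw [hs.lact_inv_lact] at h1
    rw [inv_inv]
    -- By `h1`, `b` is the right translate by `u` of `ᵘb`, so acting by `u⁻¹` on the right returns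
    -- `ᵘb`.
    conv_lhs => rw [← h1]
    rw [← hm, mul_inv_cancel]
    exact hs.one_mr0 _

end IsSolution

end YBE

theorem mainTheorem10 :
    (∀ (G : Type*) [Group G] (r : G × G → G × G) (h : YBE.IsSymmetricGroup r),
      YBE.Lri r →
        YBE.Raut r h.leftBrace ∧
        ∀ a u v : G,
          YBE.lact r (YBE.lact r v a) u * YBE.lact r a v =
            YBE.lact r a u * YBE.lact r (YBE.ract r a u) v) ∧
    (∀ (X : Type*) (r₀ : X × X → X × X) (h₀ : YBE.IsSolution r₀),
      YBE.Lri r₀ →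
      YBE.Raut h₀.braiding h₀.isSymmetricGroup.leftBrace →
        YBE.Lri h₀.braiding) := by
  refine ⟨fun G _ r h hl => ⟨h.raut_of_lri hl, fun a u v => ?_⟩,
    fun X r₀ h₀ hl hR => h₀.lri_braiding hl hR⟩
  rw [← h.lact_mul_of_lri hl]
  exact h.ml2 a u v
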